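/- Let $K\subset\mathbb{C}$ be a finite set, let $p(\lambda)=\prod_{z\in K}(\lambda-z)$, let $K^2=\{xy: x,y\in K\}$, and put $$\kappa=\inf\{|z|: z\in K^2\},\qquad \delta=\inf\{|z|: z\in K^2,\ |z|>\kappa\},$$ with $\delta=+\infty$ if there is no $z\in K^2$ with $|z|>\kappa$. For a complex unital Banach algebra $A$ with unit $\mathbf 1$, let $E(p)=\{x\in A: p(x)=0\}$. For $a\in A$ let $\operatorname{orb}(a)=\{waw^{-1}: w\in G_{\mathbf 1}(A)\}$, where $G_{\mathbf 1}(A)$ is the connected component of $\mathbf 1$ in the group of invertible elements $G(A)$. Let $\rho$ denote the spectral radius, and for $S,T\subseteq A$ write $ST=\{st: s\in S,\ t\in T\}$. Then $\delta>0$ and the following hold. (1) Suppose that exactly one element of $K^2$ has modulus $\kappa$. Then there is $\mu\in K^2$ with $|\mu|=\kappa$ such that, for every semisimple (i.e. with zero Jacobson radical) complex unital Banach algebra $A$ and all $a,b\in E(p)$, $$\sup_{r\in\operatorname{orb}(b)}\rho(ar)<\delta\quad\Longrightarrow\quad \operatorname{orb}(a)\operatorname{orb}(b)=\operatorname{orb}(b)\operatorname{orb}(a)=\{\mu\mathbf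 1\}.$$ (2) For every semisimple complex unital Banach algebra $A$ and all $a,b\in E(p)$ with $a\notin G(A)$, $$\sup_{r\in\operatorname{orb}(b)}\rho(ar)<\delta\quad\Longrightarrow\quad \operatorname{orb}(a)\operatorname{orb}(b)=\operatorname{orb}(b)\operatorname{orb}(a)=\{0\}.$$ -/

import Mathlib

open scoped Pointwise ENNReal

universe u

namespace SimilarityOrbit

/-- The principal component `G₁(A)`: the connected component of the unit `1` in the group of
invertible elements of `A` (with its usual topology). -/
def principalComponent (A : Type u) [NormedRing A] : Set Aˣ :=
  connectedComponent (1 : Aˣ)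

/-- The similarity orbit `orb(a) = {w a w⁻¹ : w ∈ G₁(A)}`. -/
def orb {A : Type u} [NormedRing A] (a : A) : Set A :=
  {x | ∃ w ∈ principalComponent A, x = (w : A) * a * ((w⁻¹ : Aˣ) : A)}

/-- The monic polynomial `∏_{z ∈ K} (X - z)` with simple roots, the elements of `K`. -/
noncomputable def rootPoly (K : Finset ℂ) : Polynomial ℂ :=
  ∏ z ∈ K, (Polynomial.X - Polynomial.C z)

/-- `E(p) = {x ∈ A : p(x) = 0}`. -/
def zeroSet (A : Type u) [NormedRing A] [NormedAlgebra ℂ A] (p : Polynomial ℂ) : Set A :=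
  {x | Polynomial.aeval x p = 0}

/-- `t₁ = sup_{r ∈ orb(b)} ρ(a r)`, as an extended nonnegative real. -/
noncomputable def orbitRadius {A : Type u} [NormedRing A] [NormedAlgebra ℂ A] (a b : A) : ℝ≥0∞ :=
  ⨆ r ∈ orb b, spectralRadius ℂ (a * r)

/-- `κ = inf {|z| : z ∈ K²}`, where `K² = K * K = {xy : x, y ∈ K}`. -/
noncomputable def kappa (K : Finset ℂ) : ℝ :=
  sInf ((fun z : ℂ => ‖z‖) '' {z | z ∈ K * K})

/-- `δ = inf {|z| : z ∈ K², |z| > κ}`, which is `∞` if there is no such `z`. -/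
noncomputable def delta (K : Finset ℂ) : ℝ≥0∞ :=
  ⨅ z ∈ {z : ℂ | z ∈ K * K ∧ kappa K < ‖z‖}, ENNReal.ofReal ‖z‖

end SimilarityOrbit

/-!
Let `X = A ⧸ L` for a maximal left ideal `L`; this is a Banach space on which `A` acts irreducibly,
and `A` is semisimple exactly when such modules detect equality in `A`. It therefore suffices to
show that products from the two orbits act as `μ` on every `X`.

The main point is a dichotomy (`orbitRadius_eq_top`): if neither `a` nor `b` acts on `X` as a
scalar, then `ρ` is unbounded on `a orb(b)`. Indeed there are `x`, `y` such that the pairs `x, b x`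
and `a y, y` are linearly independent. The endomorphisms of `X` are scalars
(`exists_end_eq_smul`, a Gelfand–Mazur argument), so by Jacobson density `A` acts densely over `ℂ`,
and products of exponentials act transitively on linearly independent pairs
(`exists_mem_principalComponent_smul_pair_eq`). For any `t ≠ 0` this gives `w ∈ G₁(A)` with
`w x = a y` and `w b x = t y`, so that `a y` is an eigenvector of
`a w b w⁻¹` for the eigenvalue `t`.

Hence if the supremum is less than `δ`, one of `a`, `b`, say `a`, acts as a scalar `α ∈ K`. Every
eigenvalue `β ∈ K` of `b` on `X` satisfies `|αβ| ≤ ρ(ab) < δ`, so `|αβ| = κ` and `αβ = μ`. If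
`α = 0`, then `κ = 0` and `μ = 0`; otherwise the only eigenvalue of `b` is `μ / α`, and since `p`
has simple roots `b` acts as the scalar `μ / α` (`mul_smul_eq_of_forall_smul_eq`). If `a` is not
invertible, then `0 ∈ K`, so `κ = 0` and `0` is the only element of `K²` of modulus `κ`.
-/

namespace SimilarityOrbit

/-! ### Exponentials in the principal component -/

section PrincipalComponent

variable {A : Type*} [NormedRing A]

theorem one_mem_principalComponent : (1 : Aˣ) ∈ principalComponent A :=
  mem_connectedComponent

theorem mul_mem_principalComponent {v w : Aˣ} (hv : v ∈ principalComponent A)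
    (hw : w ∈ principalComponent A) : v * w ∈ principalComponent A :=
  mul_mem_connectedComponent_one hv hw

/-- Every exponential lies in the principal component, being joined to `1` by the path
`t ↦ exp (t c)`. -/
theorem exists_mem_principalComponent_eq_exp [NormedAlgebra ℂ A] [CompleteSpace A] (c : A) :
    ∃ w ∈ principalComponent A, (w : A) = NormedSpace.exp c := by
  let _ : NormedAlgebra ℚ A := NormedAlgebra.restrictScalars ℚ ℂ A
  have inv : ∀ x : A, NormedSpace.exp x * NormedSpace.exp (-x) = 1 := fun x ↦ by
    rw [← NormedSpace.exp_add_of_commute (Commute.neg_right (Commute.refl x)), add_neg_cancel,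
      NormedSpace.exp_zero]
  let γ : ℂ → Aˣ := fun t ↦ ⟨NormedSpace.exp (t • c), NormedSpace.exp (-(t • c)), inv _, by
    simpa using inv (-(t • c))⟩
  have hγ : Continuous γ := by
    rw [Units.continuous_iff]
    exact ⟨NormedSpace.exp_continuous.comp (by fun_prop),
      NormedSpace.exp_continuous.comp (by fun_prop)⟩
  refine ⟨γ 1, (isPreconnected_range hγ).subset_connectedComponent ⟨0, ?_⟩ ⟨1, rfl⟩, by simp [γ]⟩
  ext
  simp [γ]

end PrincipalComponent

/-! ### Exponentials and density on simple Banach modules -/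

section SimpleModule

variable {A : Type*} [NormedRing A] [NormedAlgebra ℂ A] [CompleteSpace A]
  {X : Type*} [NormedAddCommGroup X] [NormedSpace ℂ X]
  [Module A X] [IsBoundedSMul A X] [IsScalarTower ℂ A X]

theorem exp_smul_eq_of_smul_eq {c : A} {x : X} {l : ℂ} (h : c • x = l • x) :
    NormedSpace.exp c • x = Complex.exp l • x := by
  have key : ∀ n : ℕ, c ^ n • x = l ^ n • x := by
    intro n
    induction n with
    | zero => simp
    | succ n ih => rw [pow_succ, mul_smul, h, smul_comm, ih, smul_smul, pow_succ']
  have h1 : HasSum (fun n : ℕ ↦ (((n.factorial : ℂ)⁻¹) • c ^ n) • x) (NormedSpace.exp c • x) :=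
    (NormedSpace.exp_series_hasSum_exp' (𝕂 := ℂ) c).mapL
      ((ContinuousLinearMap.lsmul ℂ A).flip x)
  have h2 : HasSum (fun n : ℕ ↦ (((n.factorial : ℂ)⁻¹) • l ^ n) • x) (Complex.exp l • x) := by
    rw [Complex.exp_eq_exp_ℂ]
    exact (NormedSpace.exp_series_hasSum_exp' (𝕂 := ℂ) l).smul_const x
  refine h1.unique ?_
  simpa only [smul_assoc, key] using h2

/-- Where `c` squares to zero, `exp c` acts as the transvection `1 + c`. -/
theorem exp_smul_eq_add_of_smul_smul_eq_zero {c : A} {x : X} (h : c • c • x = 0) :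
    NormedSpace.exp c • x = x + c • x := by
  have h1 : HasSum (fun n : ℕ ↦ (((n.factorial : ℂ)⁻¹) • c ^ n) • x) (NormedSpace.exp c • x) :=
    (NormedSpace.exp_series_hasSum_exp' (𝕂 := ℂ) c).mapL
      ((ContinuousLinearMap.lsmul ℂ A).flip x)
  have h2 : ∀ n ∉ Finset.range 2, (((n.factorial : ℂ)⁻¹) • c ^ n) • x = 0 := by
    intro n hn
    obtain ⟨m, rfl⟩ : ∃ m, n = m + 2 := ⟨n - 2, by simp at hn; omega⟩
    rw [smul_assoc, pow_add, pow_two, mul_smul, mul_smul, h, smul_zero, smul_zero]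
  rw [h1.unique (hasSum_sum_of_ne_finset_zero h2)]
  simp [Finset.sum_range_succ]

variable [CompleteSpace X] [IsSimpleModule A X]

/-- An endomorphism `f` of a simple module is continuous: by the open mapping theorem every vector
is `a • x₀` with `‖a‖` controlled by its norm, and `f (a • x₀) = a • f x₀`. -/
theorem continuous_of_end (f : Module.End A X) : Continuous f := by
  obtain ⟨x₀, hx₀⟩ := @exists_ne X (IsSimpleModule.nontrivial A X) 0
  let T : A →L[ℂ] X := (ContinuousLinearMap.lsmul ℂ A).flip x₀
  obtain ⟨C, hC, hT⟩ := T.exists_preimage_norm_le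
    (IsSimpleModule.toSpanSingleton_surjective A hx₀)
  refine AddMonoidHomClass.continuous_of_bound f (C * ‖f x₀‖) fun y ↦ ?_
  obtain ⟨a, rfl, ha⟩ := hT y
  calc ‖f (a • x₀)‖ = ‖a • f x₀‖ := by rw [map_smul]
    _ ≤ ‖a‖ * ‖f x₀‖ := norm_smul_le _ _
    _ ≤ C * ‖T a‖ * ‖f x₀‖ := by gcongr
    _ = _ := by ring

/-- Schur's lemma with scalars: an endomorphism `f` is a bounded operator, so `l - f` is not
invertible for some `l`, and a non-invertible endomorphism of a simple module vanishes. -/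
theorem exists_end_eq_smul (f : Module.End A X) : ∃ l : ℂ, ∀ x, f x = l • x := by
  have := IsSimpleModule.nontrivial A X
  let F : Module.End A X → (X →L[ℂ] X) := fun g ↦ ⟨g.restrictScalars ℂ, continuous_of_end g⟩
  obtain ⟨l, hl⟩ := spectrum.nonempty (F f)
  refine ⟨l, ?_⟩
  by_contra! hne
  obtain ⟨x, hx⟩ := hne
  let g : Module.End A X := l • 1 - f
  have hg : g ≠ 0 := fun h ↦ hx (sub_eq_zero.mp (by simpa [g] using congr($h x))).symm
  let e := LinearEquiv.ofBijective g (LinearMap.bijective_of_ne_zero hg)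
  refine hl (isUnit_iff_exists.mpr ⟨F e.symm, ?_, ?_⟩)
  · ext y
    exact e.apply_symm_apply y
  · ext y
    exact e.symm_apply_apply y

/-- Complex form of the Jacobson density theorem: `A` sends a linearly independent finite family of
vectors to an arbitrary family. -/
theorem exists_smul_eq_of_linearIndependent {ι : Type*} [Finite ι] {v : ι → X}
    (hv : LinearIndependent ℂ v) (y : ι → X) : ∃ c : A, ∀ i, c • v i = y i := by
  classical
  have := Fintype.ofFinite ι
  obtain ⟨g, hg⟩ := LinearMap.exists_extend ((Module.Basis.span hv).constr ℂ y)
  have hgv : ∀ i, g (v i) = y i := fun i ↦ by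
    have := congr($hg (Module.Basis.span hv i))
    rwa [Module.Basis.constr_basis, LinearMap.comp_apply, Submodule.subtype_apply,
      Module.Basis.span_apply] at this
  -- A `ℂ`-linear map commutes with `End_A(X)`, which consists of scalars.
  let G : Module.End (Module.End A X) X :=
    { toFun := g
      map_add' := map_add g
      map_smul' := fun f x ↦ by
        obtain ⟨l, hl⟩ := exists_end_eq_smul f
        simp [hl] }
  obtain ⟨c, hc⟩ := jacobson_density G (Finset.univ.image v)
  exact ⟨c, fun i ↦ by rw [← hc (v i) (by simp), ← hgv]; rfl⟩

end SimpleModule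

/-! ### Eigenvectors and the orbit radius -/

section Eigenvector

variable {A : Type*} [NormedRing A] [NormedAlgebra ℂ A]
  {X : Type*} [AddCommGroup X] [Module ℂ X] [Module A X] [IsScalarTower ℂ A X]

/-- An element acting with an eigenvector for the eigenvalue `t` has `t` in its spectrum. -/
theorem enorm_le_spectralRadius_of_smul_eq {c : A} {x : X} {t : ℂ} (hx : x ≠ 0)
    (h : c • x = t • x) : ‖t‖ₑ ≤ spectralRadius ℂ c := by
  refine le_iSup₂_of_le t ?_ le_rfl
  rintro ⟨u, hu⟩
  refine hx ?_
  have : (u : A) • x = 0 := by rw [hu, sub_smul, algebraMap_smul, h, sub_self]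
  simpa [smul_smul] using congr(((u⁻¹ : Aˣ) : A) • $this)

theorem enorm_le_orbitRadius_of_smul_eq {a b r : A} (hr : r ∈ orb b) {x : X} {t : ℂ} (hx : x ≠ 0)
    (h : (a * r) • x = t • x) : ‖t‖ₑ ≤ orbitRadius a b :=
  (enorm_le_spectralRadius_of_smul_eq hx h).trans (le_iSup₂_of_le r hr le_rfl)

/-- An element that does not act as a scalar moves some vector off its line. -/
theorem exists_linearIndependent_smul {a : A} (ha : ¬ ∃ l : ℂ, ∀ x : X, a • x = l • x) :
    ∃ x : X, LinearIndependent ℂ ![x, a • x] := by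
  contrapose! ha
  obtain ⟨l, hl⟩ := LinearMap.exists_eq_smul_id_of_forall_notLinearIndependent
    (f := Algebra.lsmul ℂ ℂ X a) ha
  exact ⟨l, fun x ↦ by simpa using congr($hl x)⟩

end Eigenvector

/-! ### Transitivity of the principal component and the dichotomy -/

section SimpleModule

variable {A : Type*} [NormedRing A] [NormedAlgebra ℂ A] [CompleteSpace A]
  {X : Type*} [NormedAddCommGroup X] [NormedSpace ℂ X] [CompleteSpace X]
  [Module A X] [IsBoundedSMul A X] [IsScalarTower ℂ A X] [IsSimpleModule A X]

/-- The principal component acts transitively on the nonzero vectors. -/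
theorem exists_mem_principalComponent_smul_eq {x y : X} (hx : x ≠ 0) (hy : y ≠ 0) :
    ∃ w ∈ principalComponent A, (w : A) • x = y := by
  by_cases h : LinearIndependent ℂ ![x, y]
  -- If `x` and `y` are independent, use the square-zero map sending both to `y - x`.
  · obtain ⟨c, hc⟩ := exists_smul_eq_of_linearIndependent (A := A) h ![y - x, y - x]
    have hcx : c • x = y - x := hc 0
    have hcy : c • y = y - x := hc 1
    obtain ⟨w, hw, hwc⟩ := exists_mem_principalComponent_eq_exp c
    refine ⟨w, hw, ?_⟩
    rw [hwc, exp_smul_eq_add_of_smul_smul_eq_zero, hcx, add_sub_cancel]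
    rw [hcx, smul_sub, hcx, hcy, sub_self]
  · obtain ⟨s, rfl⟩ : ∃ s : ℂ, s • x = y := by
      simpa [LinearIndependent.pair_iff' hx] using h
    have hs : s ≠ 0 := fun h ↦ hy (by simp [h])
    obtain ⟨w, hw, hwc⟩ := exists_mem_principalComponent_eq_exp (Complex.log s • (1 : A))
    refine ⟨w, hw, ?_⟩
    rw [hwc, exp_smul_eq_of_smul_eq (l := Complex.log s) (by simp), Complex.exp_log hs]

/-- The stabilizer of `p` in the principal component acts transitively on the vectors that are not
multiples of `p`. -/
theorem exists_mem_principalComponent_smul_eq_of_fixed {p x y : X}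
    (hx : LinearIndependent ℂ ![p, x]) (hy : LinearIndependent ℂ ![p, y]) :
    ∃ w ∈ principalComponent A, (w : A) • p = p ∧ (w : A) • x = y := by
  by_cases h : LinearIndependent ℂ ![p, x, y]
  · obtain ⟨c, hc⟩ := exists_smul_eq_of_linearIndependent (A := A) h ![0, y - x, y - x]
    have hcp : c • p = 0 := hc 0
    have hcx : c • x = y - x := hc 1
    have hcy : c • y = y - x := hc 2
    obtain ⟨w, hw, hwc⟩ := exists_mem_principalComponent_eq_exp c
    refine ⟨w, hw, ?_, ?_⟩
    · rw [hwc, exp_smul_eq_add_of_smul_smul_eq_zero, hcp, add_zero]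
      rw [hcp, smul_zero]
    · rw [hwc, exp_smul_eq_add_of_smul_smul_eq_zero, hcx, add_sub_cancel]
      rw [hcx, smul_sub, hcx, hcy, sub_self]
  · obtain ⟨r, s, rfl⟩ : ∃ r s : ℂ, r • p + s • x = y := by
      rw [← Submodule.mem_span_pair]
      by_contra hmem
      refine h ?_
      have hsnoc : ![p, x, y] = Fin.snoc ![p, x] y := by
        ext i
        fin_cases i <;> rfl
      rw [hsnoc]
      exact linearIndependent_finSnoc.mpr ⟨hx, by simpa [Set.pair_comm] using hmem⟩
    have hs : s ≠ 0 := by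
      rintro rfl
      have := LinearIndependent.pair_iff.mp hy r (-1) (by simp)
      simp at this
    -- First rescale `x` by `s`, then add `r • p` by a transvection.
    obtain ⟨c, hc⟩ := exists_smul_eq_of_linearIndependent (A := A) hx ![0, Complex.log s • x]
    obtain ⟨d, hd⟩ := exists_smul_eq_of_linearIndependent (A := A) hx ![0, (r / s) • p]
    have hcp : c • p = 0 := hc 0
    have hcx : c • x = Complex.log s • x := hc 1
    have hdp : d • p = 0 := hd 0
    have hdx : d • x = (r / s) • p := hd 1
    obtain ⟨v, hv, hvc⟩ := exists_mem_principalComponent_eq_exp c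
    obtain ⟨w, hw, hwd⟩ := exists_mem_principalComponent_eq_exp d
    have hwp : (w : A) • p = p := by
      rw [hwd, exp_smul_eq_add_of_smul_smul_eq_zero, hdp, add_zero]
      rw [hdp, smul_zero]
    have hwx : (w : A) • x = x + (r / s) • p := by
      rw [hwd, exp_smul_eq_add_of_smul_smul_eq_zero, hdx]
      rw [hdx, smul_comm, hdp, smul_zero]
    have hvp : (v : A) • p = p := by
      rw [hvc, exp_smul_eq_add_of_smul_smul_eq_zero, hcp, add_zero]
      rw [hcp, smul_zero]
    have hvx : (v : A) • x = s • x := by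
      rw [hvc, exp_smul_eq_of_smul_eq hcx, Complex.exp_log hs]
    refine ⟨w * v, mul_mem_principalComponent hw hv, ?_, ?_⟩
    · rw [Units.val_mul, mul_smul, hvp, hwp]
    · rw [Units.val_mul, mul_smul, hvx, smul_comm, hwx, smul_add, smul_smul, mul_div_cancel₀ _ hs,
        add_comm]

/-- A version of Sinclair's theorem: the principal component acts transitively on linearly
independent pairs of vectors. -/
theorem exists_mem_principalComponent_smul_pair_eq {x x' y y' : X}
    (hx : LinearIndependent ℂ ![x, x']) (hy : LinearIndependent ℂ ![y, y']) :
    ∃ w ∈ principalComponent A, (w : A) • x = y ∧ (w : A) • x' = y' := by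
  obtain ⟨v, hv, hvx⟩ := exists_mem_principalComponent_smul_eq (A := A) (hx.ne_zero 0)
    (hy.ne_zero 0)
  simp only [Matrix.cons_val_zero] at hvx
  have hv' : LinearIndependent ℂ ![y, (v : A) • x'] := by
    rw [LinearIndependent.pair_iff] at hx ⊢
    intro r s hrs
    refine hx r s ?_
    have h : (v : A) • (r • x + s • x') = 0 := by
      rw [smul_add, smul_comm, hvx, smul_comm (v : A), hrs]
    simpa [smul_smul] using congr(((v⁻¹ : Aˣ) : A) • $h)
  obtain ⟨w, hw, hwy, hwx⟩ := exists_mem_principalComponent_smul_eq_of_fixed (A := A) hv' hy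
  exact ⟨w * v, mul_mem_principalComponent hw hv, by rw [Units.val_mul, mul_smul, hvx, hwy],
    by rw [Units.val_mul, mul_smul, hwx]⟩

/-- If neither `a` nor `b` acts as a scalar on some simple module, the spectral radius is unbounded
on `a orb(b)`: choosing `x`, `b x` and `y`, `a y` linearly independent and `w` with `w x = a y` and
`w b x = t y`, the vector `a y` is an eigenvector of `a w b w⁻¹` for the eigenvalue `t`. -/
theorem orbitRadius_eq_top {a b : A} (ha : ¬ ∃ l : ℂ, ∀ x : X, a • x = l • x)
    (hb : ¬ ∃ l : ℂ, ∀ x : X, b • x = l • x) : orbitRadius a b = ∞ := by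
  obtain ⟨x, hx⟩ := exists_linearIndependent_smul hb
  obtain ⟨y, hy⟩ := exists_linearIndependent_smul ha
  refine ENNReal.eq_top_of_forall_nnreal_le fun R ↦ ?_
  -- The eigenvalue `R + 1` is nonzero and at least `R` in modulus.
  have ht : ((R + 1 : ℝ) : ℂ) ≠ 0 := by
    rw [Complex.ofReal_ne_zero]
    positivity
  have hy' : LinearIndependent ℂ ![a • y, ((R + 1 : ℝ) : ℂ) • y] := by
    rw [LinearIndependent.pair_iff] at hy ⊢
    intro p q hpq
    have := hy (q * ((R + 1 : ℝ) : ℂ)) p (by rw [mul_smul, add_comm, hpq])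
    exact ⟨this.2, (mul_eq_zero.mp this.1).resolve_right ht⟩
  obtain ⟨w, hw, hwx, hwb⟩ := exists_mem_principalComponent_smul_pair_eq (A := A) hx hy'
  refine le_trans ?_ (enorm_le_orbitRadius_of_smul_eq (t := ((R + 1 : ℝ) : ℂ)) (x := a • y)
    ⟨w, hw, rfl⟩ (hy.ne_zero 1) ?_)
  · rw [← ofReal_norm, Complex.norm_real, Real.norm_of_nonneg (by positivity)]
    rw [ENNReal.le_ofReal_iff_toReal_le (by simp) (by positivity)]
    simp
  · rw [← hwx, ← mul_smul]
    simp only [mul_assoc, Units.inv_mul, mul_one]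
    rw [mul_smul, mul_smul, hwb, hwx, smul_comm]

end SimpleModule

/-! ### The constants `κ` and `δ` -/

theorem kappa_nonneg (K : Finset ℂ) : 0 ≤ kappa K :=
  Real.sInf_nonneg (by rintro _ ⟨z, -, rfl⟩; exact norm_nonneg z)

theorem kappa_le {K : Finset ℂ} {z : ℂ} (hz : z ∈ K * K) : kappa K ≤ ‖z‖ :=
  csInf_le ⟨0, by rintro _ ⟨z, -, rfl⟩; exact norm_nonneg z⟩ ⟨z, hz, rfl⟩

theorem kappa_eq_zero {K : Finset ℂ} (h : 0 ∈ K) : kappa K = 0 :=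
  le_antisymm (by simpa using kappa_le (Finset.mul_mem_mul h h)) (kappa_nonneg K)

theorem delta_pos (K : Finset ℂ) : 0 < delta K := by
  have hfin : {z : ℂ | z ∈ K * K ∧ kappa K < ‖z‖}.Finite :=
    (K * K).finite_toSet.subset fun z hz ↦ hz.1
  have : delta K = hfin.toFinset.inf fun z ↦ ENNReal.ofReal ‖z‖ := by
    simp [delta, Finset.inf_eq_iInf]
  rw [this]
  refine (Finset.lt_inf_iff ENNReal.zero_lt_top).mpr fun z hz ↦ ?_
  rw [ENNReal.ofReal_pos]
  exact (kappa_nonneg K).trans_lt ((hfin.mem_toFinset.mp hz).2)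

/-- There is no modulus of an element of `K²` strictly between `κ` and `δ`. -/
theorem norm_eq_kappa_of_enorm_lt_delta {K : Finset ℂ} {z : ℂ} (hz : z ∈ K * K)
    (h : ‖z‖ₑ < delta K) : ‖z‖ = kappa K := by
  refine le_antisymm (not_lt.mp fun hlt ↦ h.not_ge ?_) (kappa_le hz)
  rw [← ofReal_norm]
  exact iInf₂_le z ⟨hz, hlt⟩

/-! ### Roots of a polynomial with simple zeros acting on a module -/

section Roots

variable {A : Type*} [NormedRing A] [NormedAlgebra ℂ A]
  {X : Type*} [AddCommGroup X] [Module ℂ X] [Module A X] [IsScalarTower ℂ A X]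

theorem aeval_smul_of_smul_eq {b : A} {x : X} {z : ℂ} (h : b • x = z • x) (p : Polynomial ℂ) :
    Polynomial.aeval b p • x = p.eval z • x := by
  induction p using Polynomial.induction_on' with
  | add p q hp hq => simp [add_smul, hp, hq]
  | monomial n c =>
    have key : b ^ n • x = z ^ n • x := by
      induction n with
      | zero => simp
      | succ n ih => rw [pow_succ, mul_smul, h, smul_comm, ih, smul_smul, pow_succ']
    simp [Polynomial.aeval_monomial, mul_smul, key]

theorem mem_of_smul_eq {K : Finset ℂ} {b : A} (hb : b ∈ zeroSet A (rootPoly K)) {x : X}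
    (hx : x ≠ 0) {z : ℂ} (h : b • x = z • x) : z ∈ K := by
  have h0 := aeval_smul_of_smul_eq h (rootPoly K)
  rw [show Polynomial.aeval b (rootPoly K) = 0 from hb, zero_smul, eq_comm, smul_eq_zero] at h0
  simpa [rootPoly, Polynomial.eval_prod, Finset.prod_eq_zero_iff, sub_eq_zero] using
    h0.resolve_right hx

theorem eq_zero_of_aeval_rootPoly_smul_eq_zero {b : A} {S : Finset ℂ}
    (hS : ∀ z ∈ S, ∀ x : X, b • x = z • x → x = 0) {x : X}
    (hx : Polynomial.aeval b (rootPoly S) • x = 0) : x = 0 := by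
  induction S using Finset.induction_on with
  | empty => simpa [rootPoly] using hx
  | insert z S hz ih =>
    refine ih (fun z hz ↦ hS z (Finset.mem_insert_of_mem hz))
      (hS z (Finset.mem_insert_self z S) _ ?_)
    rw [rootPoly, Finset.prod_insert hz, map_mul, mul_smul, map_sub, Polynomial.aeval_X,
      Polynomial.aeval_C, sub_smul, algebraMap_smul, sub_eq_zero] at hx
    exact hx

/-- Since `p` has simple roots, an element of `E(p)` acting without eigenvalues other than `β` acts
as the scalar `β`. -/
theorem smul_eq_of_forall_eigenvalue {K : Finset ℂ} {b : A} (hb : b ∈ zeroSet A (rootPoly K))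
    {β : ℂ} (h : ∀ z : ℂ, ∀ x : X, x ≠ 0 → b • x = z • x → z = β) (x : X) : b • x = β • x := by
  have hdvd : rootPoly K ∣ rootPoly (K.erase β) * (Polynomial.X - Polynomial.C β) := by
    by_cases hβ : β ∈ K
    · exact (Finset.prod_erase_mul K _ hβ).symm.dvd
    · rw [Finset.erase_eq_of_notMem hβ]
      exact dvd_mul_right _ _
  have h0 : Polynomial.aeval b (rootPoly (K.erase β) * (Polynomial.X - Polynomial.C β)) = 0 := by
    obtain ⟨q, hq⟩ := hdvd
    rw [hq, map_mul, show Polynomial.aeval b (rootPoly K) = 0 from hb, zero_mul]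
  have h1 : b • x - β • x = 0 := by
    refine eq_zero_of_aeval_rootPoly_smul_eq_zero (b := b) (S := K.erase β) (fun z hz y hy ↦ ?_) ?_
    · by_contra hne
      exact Finset.ne_of_mem_erase hz (h z y hne hy)
    · simpa [mul_smul, sub_smul] using congr($h0 • x)
  exact sub_eq_zero.mp h1

theorem smul_eq_of_mem_orb {a r : A} (hr : r ∈ orb a) {α : ℂ} (h : ∀ x : X, a • x = α • x)
    (x : X) : r • x = α • x := by
  obtain ⟨w, -, rfl⟩ := hr
  rw [mul_smul, mul_smul, h, smul_comm, smul_smul (w : A), Units.mul_inv, one_smul]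

/-- If `a` acts as a scalar `α` and every product of `α` with an eigenvalue of `b` equals `μ`, then
either `α = μ = 0` or `b` acts as `μ / α`; either way products from the two orbits act as `μ`. -/
theorem mul_smul_eq_of_forall_smul_eq [Nontrivial X] {K : Finset ℂ} {a b : A}
    (ha : a ∈ zeroSet A (rootPoly K)) (hb : b ∈ zeroSet A (rootPoly K)) {α μ : ℂ}
    (hα : ∀ x : X, a • x = α • x) (hμ₀ : 0 ∈ K → μ = 0)
    (hμ : ∀ β : ℂ, ∀ x : X, x ≠ 0 → b • x = β • x → α * β = μ) {r s : A} (hr : r ∈ orb a)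
    (hs : s ∈ orb b) (x : X) : (r * s) • x = μ • x ∧ (s * r) • x = μ • x := by
  have hr' := smul_eq_of_mem_orb hr hα
  obtain ⟨x₀, hx₀⟩ := exists_ne (0 : X)
  by_cases h0 : α = 0
  · have := hμ₀ (h0 ▸ mem_of_smul_eq ha hx₀ (hα x₀))
    simp [mul_smul, hr', h0, this]
  · have hs' := smul_eq_of_mem_orb (X := X) hs <| smul_eq_of_forall_eigenvalue hb fun β x hx hβ ↦
      eq_div_of_mul_eq h0 ((mul_comm β α).trans (hμ β x hx hβ))
    rw [mul_smul, mul_smul, hs', hr', hr', hs', smul_smul, smul_smul, mul_div_cancel₀ _ h0,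
      div_mul_cancel₀ _ h0]
    exact ⟨rfl, rfl⟩

end Roots

/-! ### Products of similarity orbits -/

theorem self_mem_orb {A : Type*} [NormedRing A] (a : A) : a ∈ orb a :=
  ⟨1, one_mem_principalComponent, by simp⟩

section Algebra

variable {A : Type*} [NormedRing A] [NormedAlgebra ℂ A]

theorem zero_mem_of_not_isUnit {K : Finset ℂ} {a : A} (ha : a ∈ zeroSet A (rootPoly K))
    (hu : ¬ IsUnit a) : 0 ∈ K := by
  have : Nontrivial A := not_subsingleton_iff_nontrivial.mp fun _ ↦ hu (isUnit_of_subsingleton a)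
  have h0 : (0 : ℂ) ∈ spectrum ℂ a := spectrum.zero_mem ℂ hu
  have := spectrum.subset_polynomial_aeval a (rootPoly K) ⟨0, h0, rfl⟩
  rw [show Polynomial.aeval a (rootPoly K) = 0 from ha, spectrum.zero_eq] at this
  simpa [rootPoly, Polynomial.eval_prod, Finset.prod_eq_zero_iff] using this

variable [CompleteSpace A]

/-- On a simple module the dichotomy leaves only the cases where `a` or `b` acts as a scalar. -/
theorem mul_smul_eq_of_orbitRadius_lt {X : Type*} [NormedAddCommGroup X] [NormedSpace ℂ X]
    [CompleteSpace X] [Module A X] [IsBoundedSMul A X] [IsScalarTower ℂ A X] [IsSimpleModule A X]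
    {K : Finset ℂ} {μ : ℂ} (hμ : ∀ z ∈ K * K, ‖z‖ = kappa K → z = μ) {a b : A}
    (ha : a ∈ zeroSet A (rootPoly K)) (hb : b ∈ zeroSet A (rootPoly K))
    (hab : orbitRadius a b < delta K) {r s : A} (hr : r ∈ orb a) (hs : s ∈ orb b) (x : X) :
    (r * s) • x = μ • x ∧ (s * r) • x = μ • x := by
  have := IsSimpleModule.nontrivial A X
  have hμ₀ (h0 : 0 ∈ K) : μ = 0 :=
    (hμ 0 (by simpa using Finset.mul_mem_mul h0 h0) (by simp [kappa_eq_zero h0])).symm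
  have hprod {α β : ℂ} (hα : α ∈ K) (hβ : β ∈ K) {x : X} (hx : x ≠ 0)
      (h : (a * b) • x = (α * β) • x) : α * β = μ :=
    have hαβ := Finset.mul_mem_mul hα hβ
    hμ _ hαβ <| norm_eq_kappa_of_enorm_lt_delta hαβ <|
      (enorm_le_orbitRadius_of_smul_eq (self_mem_orb b) hx h).trans_lt hab
  by_cases h : ∃ α : ℂ, ∀ x : X, a • x = α • x
  · obtain ⟨α, hα⟩ := h
    refine mul_smul_eq_of_forall_smul_eq ha hb hα hμ₀ (fun β y hy hβ ↦ ?_) hr hs x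
    exact hprod (mem_of_smul_eq ha hy (hα y)) (mem_of_smul_eq hb hy hβ) hy
      (by rw [mul_smul, hβ, hα, smul_smul])
  by_cases h' : ∃ β : ℂ, ∀ x : X, b • x = β • x
  · obtain ⟨β, hβ⟩ := h'
    refine (mul_smul_eq_of_forall_smul_eq hb ha hβ hμ₀ (fun α y hy hα ↦ ?_) hs hr x).symm
    rw [mul_comm]
    exact hprod (mem_of_smul_eq ha hy hα) (mem_of_smul_eq hb hy (hβ y)) hy
      (by rw [mul_smul, hβ, smul_comm, hα, smul_smul, mul_comm])
  · exact absurd hab (by simp [orbitRadius_eq_top h h'])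

/-- The action on all `A ⧸ L`, with `L` a maximal left ideal, determines elements of a semisimple
algebra, so the identities on simple modules lift to `A`. -/
theorem mul_eq_of_orbitRadius_lt (hA : Ring.jacobson A = ⊥) {K : Finset ℂ} {μ : ℂ}
    (hμ : ∀ z ∈ K * K, ‖z‖ = kappa K → z = μ) {a b : A} (ha : a ∈ zeroSet A (rootPoly K))
    (hb : b ∈ zeroSet A (rootPoly K)) (hab : orbitRadius a b < delta K) {r s : A}
    (hr : r ∈ orb a) (hs : s ∈ orb b) : r * s = μ • 1 ∧ s * r = μ • 1 := by
  have key : ∀ c : A, (∀ L : Ideal A, L.IsMaximal →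
      c • (Submodule.Quotient.mk 1 : A ⧸ L) = μ • (Submodule.Quotient.mk 1 : A ⧸ L)) →
      c = μ • 1 := by
    intro c hc
    rw [← sub_eq_zero, ← Submodule.mem_bot A, ← hA, Ring.jacobson, Module.jacobson,
      Submodule.mem_sInf]
    intro L hL
    have := hc L ⟨hL⟩
    rwa [← Submodule.Quotient.mk_smul, ← Submodule.Quotient.mk_smul, Submodule.Quotient.eq,
      smul_eq_mul, mul_one] at this
  have hL : ∀ L : Ideal A, L.IsMaximal → ∀ x : A ⧸ L,
      (r * s) • x = μ • x ∧ (s * r) • x = μ • x := by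
    intro L hL
    have : IsClosed (L : Set A) := Ideal.IsMaximal.isClosed
    have : IsSimpleModule A (A ⧸ L) := isSimpleModule_iff_isCoatom.mpr hL.out
    -- The corresponding instance is only available as an instance over commutative rings.
    have : IsBoundedSMul A (A ⧸ L) := .of_norm_smul_le fun c x ↦ by
      refine le_of_forall_pos_le_add fun ε hε ↦ ?_
      have hc : 0 < ‖c‖ + 1 := by positivity
      obtain ⟨d, rfl, hd⟩ := Submodule.Quotient.norm_mk_lt x (div_pos hε hc)
      calc ‖c • (Submodule.Quotient.mk d : A ⧸ L)‖ ≤ ‖c * d‖ := Submodule.Quotient.norm_mk_le L _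
        _ ≤ ‖c‖ * ‖d‖ := norm_mul_le c d
        _ ≤ ‖c‖ * (‖(Submodule.Quotient.mk d : A ⧸ L)‖ + ε / (‖c‖ + 1)) := by gcongr
        _ = ‖c‖ * ‖(Submodule.Quotient.mk d : A ⧸ L)‖ + ‖c‖ / (‖c‖ + 1) * ε := by ring
        _ ≤ _ := by
          gcongr
          exact mul_le_of_le_one_left hε.le ((div_le_one hc).mpr (by linarith))
    exact mul_smul_eq_of_orbitRadius_lt (X := A ⧸ L) hμ ha hb hab hr hs
  exact ⟨key _ fun L h ↦ (hL L h _).1, key _ fun L h ↦ (hL L h _).2⟩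

theorem orb_mul_orb_eq_of_orbitRadius_lt (hA : Ring.jacobson A = ⊥) {K : Finset ℂ} {μ : ℂ}
    (hμ : ∀ z ∈ K * K, ‖z‖ = kappa K → z = μ) {a b : A} (ha : a ∈ zeroSet A (rootPoly K))
    (hb : b ∈ zeroSet A (rootPoly K)) (hab : orbitRadius a b < delta K) :
    orb a * orb b = {μ • (1 : A)} ∧ orb b * orb a = {μ • (1 : A)} := by
  refine ⟨(Set.Nonempty.subset_singleton_iff ?_).mp ?_,
    (Set.Nonempty.subset_singleton_iff ?_).mp ?_⟩
  · exact ⟨_, Set.mul_mem_mul (self_mem_orb a) (self_mem_orb b)⟩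
  · exact Set.mul_subset_iff.mpr fun r hr s hs ↦ (mul_eq_of_orbitRadius_lt hA hμ ha hb hab hr hs).1
  · exact ⟨_, Set.mul_mem_mul (self_mem_orb b) (self_mem_orb a)⟩
  · exact Set.mul_subset_iff.mpr fun s hs r hr ↦ (mul_eq_of_orbitRadius_lt hA hμ ha hb hab hr hs).2

end Algebra

end SimilarityOrbit

theorem mainTheorem7 (K : Finset ℂ) :
    ∃ δ : ℝ≥0∞, 0 < δ ∧ δ = SimilarityOrbit.delta K ∧
      (Set.ncard {z : ℂ | z ∈ K * K ∧ ‖z‖ = SimilarityOrbit.kappa K} = 1 →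
        ∃ μ : ℂ, μ ∈ K * K ∧ ‖μ‖ = SimilarityOrbit.kappa K ∧
          ∀ (A : Type u) [NormedRing A] [NormedAlgebra ℂ A] [CompleteSpace A],
            Ring.jacobson A = ⊥ →
            ∀ a ∈ SimilarityOrbit.zeroSet A (SimilarityOrbit.rootPoly K),
            ∀ b ∈ SimilarityOrbit.zeroSet A (SimilarityOrbit.rootPoly K),
              SimilarityOrbit.orbitRadius a b < δ →
                SimilarityOrbit.orb a * SimilarityOrbit.orb b = {μ • (1 : A)} ∧
                SimilarityOrbit.orb b * SimilarityOrbit.orb a = {μ • (1 : A)}) ∧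
      (∀ (A : Type u) [NormedRing A] [NormedAlgebra ℂ A] [CompleteSpace A],
        Ring.jacobson A = ⊥ →
        ∀ a ∈ SimilarityOrbit.zeroSet A (SimilarityOrbit.rootPoly K),
        ∀ b ∈ SimilarityOrbit.zeroSet A (SimilarityOrbit.rootPoly K),
          ¬ IsUnit a →
          SimilarityOrbit.orbitRadius a b < δ →
            SimilarityOrbit.orb a * SimilarityOrbit.orb b = {(0 : A)} ∧
            SimilarityOrbit.orb b * SimilarityOrbit.orb a = {(0 : A)}) := by
  refine ⟨SimilarityOrbit.delta K, SimilarityOrbit.delta_pos K, rfl, fun h ↦ ?_, ?_⟩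
  · obtain ⟨μ, hμ⟩ := Set.ncard_eq_one.mp h
    have hmem : μ ∈ {z : ℂ | z ∈ K * K ∧ ‖z‖ = SimilarityOrbit.kappa K} := hμ ▸ rfl
    refine ⟨μ, hmem.1, hmem.2, fun A _ _ _ hA a ha b hb hab ↦ ?_⟩
    refine SimilarityOrbit.orb_mul_orb_eq_of_orbitRadius_lt hA (fun z hz hzκ ↦ ?_) ha hb hab
    have : z ∈ {z : ℂ | z ∈ K * K ∧ ‖z‖ = SimilarityOrbit.kappa K} := ⟨hz, hzκ⟩
    rwa [hμ] at this
  · intro A _ _ _ hA a ha b hb hu hab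
    have hκ := SimilarityOrbit.kappa_eq_zero (SimilarityOrbit.zero_mem_of_not_isUnit ha hu)
    have := SimilarityOrbit.orb_mul_orb_eq_of_orbitRadius_lt (μ := 0) hA
      (fun z _ hz ↦ norm_eq_zero.mp (hz.trans hκ)) ha hb hab
    rwa [zero_smul] at this
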